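/- Let $N\ge 1$ be an integer, let $1<p<\infty$, let $p'$ be the conjugate exponent of $p$ ($1/p+1/p'=1$), let $\alpha\in\mathbb{R}$, and let $L=(1+|x|^\alpha)\Delta$ on $\mathbb{R}^N$, where $|x|$ is the Euclidean norm. Denote by $C_c^\infty(\mathbb{R}^N)$ the space of $C^\infty$ functions with compact support, and by $L^p(\mathbb{R}^N)$ the Lebesgue space with respect to Lebesgue measure (functions are real- or complex-valued; the statement holds in both cases). (i) If $\alpha=N/p'$, then $L(C_c^\infty(\mathbb{R}^N))=\{Lu : u\in C_c^\infty(\mathbb{R}^N)\}$ is dense in $L^p(\mathbb{R}^N)$. (ii) If $\alpha>N/p'$, then $L(C_c^\infty(\mathbb{R}^N))$ is not dense in $L^p(\mathbb{R}^N)$. -/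

import Mathlib

open MeasureTheory
open scoped ENNReal

noncomputable section

/-- The operator `L = (1 + |x|^α) Δ` on functions `ℝ^N → 𝕜` (`𝕜 = ℝ` or `ℂ`),
`|x|` being the Euclidean norm. -/
def opL {𝕜 : Type*} [RCLike 𝕜] (N : ℕ) (α : ℝ)
    (u : EuclideanSpace ℝ (Fin N) → 𝕜) : EuclideanSpace ℝ (Fin N) → 𝕜 :=
  fun x => (1 + ‖x‖ ^ α) • Laplacian.laplacian u x

/-- `C_c^∞(ℝ^N)`: smooth, compactly supported functions `ℝ^N → 𝕜`. -/
def testFunctions (𝕜 : Type*) [RCLike 𝕜] (N : ℕ) : Set (EuclideanSpace ℝ (Fin N) → 𝕜) :=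
  {u | ContDiff ℝ ((⊤ : ℕ∞) : WithTop ℕ∞) u ∧ HasCompactSupport u}

/-- For `α ≥ 0`, the operator `L` maps `C_c^∞(ℝ^N)` into `L^p(ℝ^N)`, for every `p`. -/
theorem memLp_opL {𝕜 : Type*} [RCLike 𝕜] {N : ℕ} {α : ℝ} (hα : 0 ≤ α) (p : ℝ≥0∞)
    {u : EuclideanSpace ℝ (Fin N) → 𝕜} (hu : u ∈ testFunctions 𝕜 N) :
    MemLp (opL N α u) p volume := by
  obtain ⟨hs, hc⟩ := hu
  have hL : Continuous (Laplacian.laplacian u) := by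
    rw [InnerProductSpace.laplacian_eq_iteratedFDeriv_stdOrthonormalBasis]
    have h2 := hs.continuous_iteratedFDeriv (m := 2) (by
      change ((2 : ℕ∞) : WithTop ℕ∞) ≤ _
      exact WithTop.coe_le_coe.mpr le_top)
    refine continuous_finsetSum _ fun i _ => ?_
    exact (ContinuousEval.continuous_eval).comp (h2.prodMk continuous_const)
  have hLc : HasCompactSupport (Laplacian.laplacian u) := by
    rw [InnerProductSpace.laplacian_eq_iteratedFDeriv_stdOrthonormalBasis]
    refine (hc.iteratedFDeriv (𝕜 := ℝ) 2).mono fun x hx => ?_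
    contrapose! hx
    simp_all
  refine Continuous.memLp_of_hasCompactSupport ?_ ?_
  · have hw : Continuous fun x : EuclideanSpace ℝ (Fin N) => 1 + ‖x‖ ^ α :=
      continuous_const.add (continuous_norm.rpow_const fun _ => Or.inr hα)
    exact hw.smul hL
  · refine hLc.mono fun x hx hx0 => hx ?_
    simp only [opL, hx0, smul_zero]

/-- `L(C_c^∞(ℝ^N))` as a subset of the Lebesgue space `L^p(ℝ^N; 𝕜)`: the classes of the
functions `L u`, `u ∈ C_c^∞(ℝ^N)`. -/
def imageL (𝕜 : Type*) [RCLike 𝕜] (N : ℕ) (α : ℝ) (p : ℝ≥0∞) :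
    Set (Lp 𝕜 p (volume : Measure (EuclideanSpace ℝ (Fin N)))) :=
  {f | ∃ u ∈ testFunctions 𝕜 N, f =ᵐ[volume] opL N α u}

end

open Filter Topology

/-! Density is tested by duality. A real functional vanishing on the range of `L` is integration
against some `g ∈ L^q`, with `q` conjugate to `p` (`exists_memLp_apply_eq_integral`), and it
vanishes exactly because `v = (1 + |x|^α) g` is harmonic in the sense of distributions.

If `α q = N`, then `v = 0`; this is a Liouville theorem, proved without any regularity theory.
Average `v` around `y` against a smooth radial kernel of width `1 / k`. The derivative of the kernel
in `k` is a multiple of the Laplacian of a compactly supported radial function, so the average does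
not depend on `k` (`radialMean_eq_of_weakly_harmonic`). As `k → ∞` it tends to a positive multiple
of `v y` for almost every `y`, by Lebesgue differentiation (`ae_tendsto_radialMean_atTop`). As `k →
0`, Hölder bounds it by a constant times `(k^N ∫_{|x-y| ≤ 1/k} |v|^q)^{1/q}`. On that ball the
weight to the power `q` is at most a multiple of `k^{-N}`, which only just balances `k^N`; dominated
convergence with majorant a multiple of `|g|^q` then makes the limit zero
(`tendsto_radialMean_zero`). Complex scalars reduce to real and imaginary parts.

If `α q > N`, the function `1 / (1 + |x|^α)` itself lies in `L^q`. Pairing with it is a nonzero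
continuous functional which sends `L u` to `∫ Δu = 0`, so the range is not dense
(`not_dense_imageL`). -/

/-! ### Representation of continuous linear functionals on `L^p` -/

section LpDual

variable {X : Type*} [MeasurableSpace X] {μ : Measure X} {p : ℝ≥0∞}

/-- Dominated convergence in `L^p`, `p < ∞`. -/
theorem tendsto_toLp_of_dominated [Fact (1 ≤ p)] (hp : p ≠ ⊤) {ι : Type*} {l : Filter ι}
    [l.IsCountablyGenerated] {F : ι → X → ℝ} {f b : X → ℝ} (hF : ∀ i, MemLp (F i) p μ)
    (hf : MemLp f p μ) (hb : MemLp b p μ) (hFb : ∀ i x, |F i x| ≤ b x)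
    (hlim : ∀ x, Tendsto (fun i => F i x) l (𝓝 (f x))) :
    Tendsto (fun i => (hF i).toLp (F i)) l (𝓝 (hf.toLp f)) := by
  have hp0 : p ≠ 0 := (zero_lt_one.trans_le (Fact.out : 1 ≤ p)).ne'
  have hpp : 0 < p.toReal := ENNReal.toReal_pos hp0 hp
  rw [Lp.tendsto_Lp_iff_tendsto_eLpNorm'']
  have hfb : MemLp (fun x => b x + |f x|) p μ := hb.add hf.norm
  have key : Tendsto (fun i => ∫⁻ x, ‖(F i - f) x‖ₑ ^ p.toReal ∂μ) l (𝓝 (∫⁻ _, 0 ∂μ)) := by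
    refine tendsto_lintegral_filter_of_dominated_convergence'
      (fun x => ‖b x + |f x|‖ₑ ^ p.toReal) ?_ ?_ ?_ ?_
    · exact Eventually.of_forall fun i =>
        (((hF i).sub hf).aestronglyMeasurable.enorm.pow_const _)
    · refine Eventually.of_forall fun i => Eventually.of_forall fun x => ?_
      refine ENNReal.rpow_le_rpow ?_ hpp.le
      rw [enorm_le_iff_norm_le]
      simp only [Pi.sub_apply, Real.norm_eq_abs]
      refine (abs_sub _ _).trans (le_trans ?_ (le_abs_self _))
      gcongr
      exact hFb i x
    · have := hfb.eLpNorm_lt_top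
      rw [eLpNorm_lt_top_iff_lintegral_rpow_enorm_lt_top hp0 hp] at this
      exact this.ne
    · refine Eventually.of_forall fun x => ?_
      have h1 : Tendsto (fun i => (F i - f) x) l (𝓝 0) := by
        simpa using (hlim x).sub_const (f x)
      have h2 := (h1.enorm).ennrpow_const p.toReal
      simpa [ENNReal.zero_rpow_of_pos hpp] using h2
  have := key.ennrpow_const (1 / p.toReal)
  simp only [lintegral_zero, ENNReal.zero_rpow_of_pos (one_div_pos.2 hpp)] at this
  refine this.congr fun i => ?_
  rw [eLpNorm_eq_lintegral_rpow_enorm_toReal hp0 hp]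

theorem toLp_eq_zero_of_ae {f : X → ℝ} (hf : MemLp f p μ) (h : f =ᵐ[μ] 0) : hf.toLp f = 0 :=
  (MemLp.toLp_congr hf MemLp.zero h).trans (MemLp.toLp_zero _)

/-- A continuous linear functional on `L^p` has, relative to a fixed nonnegative weight
`ρ ∈ L^p`, a density with respect to `μ`. -/
theorem exists_integrable_setIntegral_eq [SigmaFinite μ] [Fact (1 ≤ p)] (hp : p ≠ ⊤)
    (Λ : Lp ℝ p μ →L[ℝ] ℝ) {ρ : X → ℝ} (hρ : MemLp ρ p μ) (hρ0 : ∀ x, 0 ≤ ρ x) :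
    ∃ h : X → ℝ, Measurable h ∧ Integrable h μ ∧ ∀ (A : Set X) (hA : MeasurableSet A),
      Λ ((hρ.indicator hA).toLp _) = ∫ x in A, h x ∂μ := by
  classical
  -- The set function `A ↦ Λ (1_A ρ)` is finite on every measurable set, even when `μ` is infinite,
  -- because `ρ ∈ L^p`. Its Radon–Nikodym derivative is the required density.
  let ν : SignedMeasure X :=
    { measureOf' := fun A =>
        if hA : MeasurableSet A then Λ ((hρ.indicator hA).toLp (A.indicator ρ)) else 0
      empty' := by
        rw [dif_pos MeasurableSet.empty]
        have : (hρ.indicator MeasurableSet.empty).toLp ((∅ : Set X).indicator ρ) = 0 := by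
          exact toLp_eq_zero_of_ae _ (Eventually.of_forall fun x => by simp)
        rw [this, map_zero]
      not_measurable' := fun A hA => dif_neg hA
      m_iUnion' := fun f hf hd => by
        rw [dif_pos (MeasurableSet.iUnion hf)]
        simp only [dif_pos (hf _)]
        have hU (s : Finset ℕ) : MeasurableSet (⋃ i ∈ s, f i) :=
          Finset.measurableSet_biUnion _ fun i _ => hf i
        -- The sum must converge unconditionally, so the limit is along finite index sets; `ρ`
        -- dominates all partial unions.
        have hlim : Tendsto (fun s : Finset ℕ =>
            Λ ((hρ.indicator (hU s)).toLp ((⋃ i ∈ s, f i).indicator ρ))) atTop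
            (𝓝 (Λ ((hρ.indicator (MeasurableSet.iUnion hf)).toLp ((⋃ i, f i).indicator ρ)))) := by
          refine (Λ.continuous.tendsto _).comp ?_
          refine tendsto_toLp_of_dominated hp (fun s => hρ.indicator (hU s)) _ hρ ?_ ?_
          · intro s x
            rw [abs_of_nonneg (Set.indicator_nonneg (fun x _ => hρ0 x) x)]
            exact Set.indicator_le_self' (fun x _ => hρ0 x) x
          · intro x
            exact (tendsto_indicator_biUnion_finset f ρ x).trans (pure_le_nhds _)
        refine hlim.congr fun s => ?_
        induction s using Finset.induction_on with
        | empty =>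
          have : (hρ.indicator (hU ∅)).toLp ((⋃ i ∈ (∅ : Finset ℕ), f i).indicator ρ) = 0 := by
            exact toLp_eq_zero_of_ae _ (Eventually.of_forall fun x => by simp)
          rw [this, map_zero, Finset.sum_empty]
        | insert a s has ih =>
          rw [Finset.sum_insert has, ← ih, ← map_add, ← MemLp.toLp_add]
          congr 1
          refine MemLp.toLp_congr _ _ (Eventually.of_forall fun x => ?_)
          have : (⋃ i ∈ insert a s, f i) = f a ∪ ⋃ i ∈ s, f i := by simp
          rw [this, Set.indicator_union_of_disjoint]
          · rfl
          · rw [Set.disjoint_iUnion₂_right]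
            intro i hi
            exact hd (by rintro rfl; exact has hi) }
  have hν (A : Set X) (hA : MeasurableSet A) :
      ν A = Λ ((hρ.indicator hA).toLp (A.indicator ρ)) := dif_pos hA
  have hac : ν ≪ᵥ μ.toENNRealVectorMeasure := by
    refine VectorMeasure.AbsolutelyContinuous.mk fun A hA h0 => ?_
    rw [Measure.toENNRealVectorMeasure_apply_measurable hA] at h0
    have : (hρ.indicator hA).toLp (A.indicator ρ) = 0 := by
      exact toLp_eq_zero_of_ae _ (indicator_meas_zero h0)
    rw [hν A hA, this, map_zero]
  refine ⟨ν.rnDeriv μ, ν.measurable_rnDeriv μ, ν.integrable_rnDeriv μ, fun A hA => ?_⟩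
  rw [← hν A hA, ← withDensityᵥ_apply (ν.integrable_rnDeriv μ) hA,
    SignedMeasure.withDensityᵥ_rnDeriv_eq ν μ hac]

theorem memLp_mul_of_abs_le {ρ φ : X → ℝ} (hρ : MemLp ρ p μ) (hφ : Measurable φ) {C : ℝ}
    (hC : ∀ x, |φ x| ≤ C) : MemLp (fun x => φ x * ρ x) p μ :=
  hρ.of_le_mul (c := C) (hφ.aestronglyMeasurable.mul hρ.1) (Eventually.of_forall fun x => by
    rw [norm_mul]; exact mul_le_mul_of_nonneg_right (hC x) (norm_nonneg _))

/-- Linearity passes from indicators to simple functions, and dominated convergence on both sides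
passes to bounded measurable multipliers of `ρ`. -/
theorem apply_toLp_mul_eq_integral_of_abs_le [Fact (1 ≤ p)] (hp : p ≠ ⊤)
    (Λ : Lp ℝ p μ →L[ℝ] ℝ) {ρ h : X → ℝ} (hρ : MemLp ρ p μ) (hρ0 : ∀ x, 0 ≤ ρ x)
    (hh : Integrable h μ) (hA : ∀ (A : Set X) (hA : MeasurableSet A),
      Λ ((hρ.indicator hA).toLp _) = ∫ x in A, h x ∂μ)
    {φ : X → ℝ} (hφ : Measurable φ) {C : ℝ} (hC : ∀ x, |φ x| ≤ C) :
    Λ ((memLp_mul_of_abs_le hρ hφ hC).toLp _) = ∫ x, φ x * h x ∂μ := by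
  have hsimple : ∀ (s : SimpleFunc X ℝ) (hs : MemLp (fun x => s x * ρ x) p μ),
      Λ (hs.toLp _) = ∫ x, s x * h x ∂μ := by
    intro s
    induction s using SimpleFunc.induction with
    | const c hs =>
      rename_i A
      intro hm
      have e1 : hm.toLp _ = c • (hρ.indicator hs).toLp (A.indicator ρ) := by
        rw [← MemLp.toLp_const_smul]
        refine MemLp.toLp_congr _ _ (Eventually.of_forall fun x => ?_)
        by_cases hx : x ∈ A <;> simp [hx]
      rw [e1, map_smul, hA A hs, ← integral_indicator hs, ← integral_smul]
      congr 1 with x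
      by_cases hx : x ∈ A <;> simp [hx]
    | add hd hf hg =>
      rename_i f g
      intro hm
      have hb (s : SimpleFunc X ℝ) : ∃ C, ∀ x, ‖s x‖ ≤ C := s.exists_forall_norm_le
      obtain ⟨Cf, hCf⟩ := hb f
      obtain ⟨Cg, hCg⟩ := hb g
      have mf := memLp_mul_of_abs_le hρ f.measurable hCf
      have mg := memLp_mul_of_abs_le hρ g.measurable hCg
      have e1 : hm.toLp _ = mf.toLp _ + mg.toLp _ := by
        rw [← MemLp.toLp_add]
        refine MemLp.toLp_congr _ _ (Eventually.of_forall fun x => ?_)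
        simp [add_mul]
      rw [e1, map_add, hf mf, hg mg, ← integral_add]
      · congr 1 with x
        simp [add_mul]
      · exact hh.bdd_mul f.measurable.aestronglyMeasurable (Eventually.of_forall hCf)
      · exact hh.bdd_mul g.measurable.aestronglyMeasurable (Eventually.of_forall hCg)
  let s : ℕ → SimpleFunc X ℝ := SimpleFunc.approxOn φ hφ Set.univ 0 trivial
  -- The approximants built from the base point `0` satisfy `|s n x| ≤ |φ x| + |φ x|`, whence the
  -- factor `2`.
  have hsle (n : ℕ) (x : X) : |s n x| ≤ 2 * C := by
    have := SimpleFunc.norm_approxOn_zero_le hφ (s := Set.univ) trivial x n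
    have h2 := hC x
    simp only [Real.norm_eq_abs] at this
    change |s n x| ≤ _ at this
    linarith
  have hslim (x : X) : Tendsto (fun n => s n x) atTop (𝓝 (φ x)) :=
    SimpleFunc.tendsto_approxOn hφ (Set.mem_univ 0) (by simp)
  have hms (n : ℕ) := memLp_mul_of_abs_le hρ (s n).measurable (hsle n)
  have l1 : Tendsto (fun n => Λ ((hms n).toLp _)) atTop
      (𝓝 (Λ ((memLp_mul_of_abs_le hρ hφ hC).toLp _))) := by
    refine (Λ.continuous.tendsto _).comp ?_
    refine tendsto_toLp_of_dominated hp hms _ (hρ.const_mul (2 * C)) ?_ ?_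
    · intro n x
      rw [abs_mul, abs_of_nonneg (hρ0 x)]
      exact mul_le_mul_of_nonneg_right (hsle n x) (hρ0 x)
    · exact fun x => (hslim x).mul_const _
  have l2 : Tendsto (fun n => Λ ((hms n).toLp _)) atTop (𝓝 (∫ x, φ x * h x ∂μ)) := by
    simp only [fun n => hsimple (s n) (hms n)]
    refine tendsto_integral_of_dominated_convergence (fun x => 2 * C * ‖h x‖) ?_ ?_ ?_ ?_
    · exact fun n => (s n).measurable.aestronglyMeasurable.mul hh.1
    · exact hh.norm.const_mul _
    · intro n
      refine Eventually.of_forall fun x => ?_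
      rw [norm_mul]
      exact mul_le_mul_of_nonneg_right (hsle n x) (norm_nonneg _)
    · exact Eventually.of_forall fun x => (hslim x).mul_const _
  exact tendsto_nhds_unique l1 l2

/-- The constant `1` need not lie in `L^p` when `μ` is infinite. The weight `r^{1/p}`, with `r > 0`
of finite integral supplied by σ-finiteness, takes its place. -/
theorem exists_pos_memLp [SigmaFinite μ] (hp0 : p ≠ 0) (hp : p ≠ ⊤) :
    ∃ ρ : X → ℝ, Measurable ρ ∧ (∀ x, 0 < ρ x) ∧ MemLp ρ p μ := by
  have hpp : 0 < p.toReal := ENNReal.toReal_pos hp0 hp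
  obtain ⟨r, hr0, hrm, hr⟩ := exists_pos_lintegral_lt_of_sigmaFinite μ one_ne_zero
  have hm : Measurable fun x => ((r x ^ (1 / p.toReal) : NNReal) : ℝ) :=
    (hrm.pow_const _).coe_nnreal_real
  refine ⟨_, hm, fun x => NNReal.coe_pos.2 (NNReal.rpow_pos (hr0 x)), hm.aestronglyMeasurable, ?_⟩
  rw [eLpNorm_lt_top_iff_lintegral_rpow_enorm_lt_top hp0 hp]
  refine lt_of_le_of_lt (lintegral_mono fun x => ?_) (hr.trans ENNReal.one_lt_top)
  rw [← ofReal_norm, Real.norm_of_nonneg (NNReal.coe_nonneg _), ENNReal.ofReal_coe_nnreal,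
    ← ENNReal.coe_rpow_of_nonneg _ hpp.le, ← NNReal.rpow_mul, one_div_mul_cancel hpp.ne',
    NNReal.rpow_one]

/-- If `g` is bounded on `E` and `∫_E |g|^q` is controlled by the dual pairing, then
`∫_E |g|^q ≤ ‖Λ‖^q`. -/
theorem lintegral_rpow_le_of_pairing [Fact (1 ≤ p)] (hp : p ≠ ⊤) {q : ℝ}
    (hpq : p.toReal.HolderConjugate q) (Λ : Lp ℝ p μ →L[ℝ] ℝ) {g ρ : X → ℝ} (hg : Measurable g)
    (hρ : MemLp ρ p μ) (hρ0 : ∀ x, 0 < ρ x)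
    (hΛ : ∀ (f : X → ℝ) (hf : MemLp f p μ), Measurable f → (∃ C, ∀ x, |f x| ≤ C * ρ x) →
      Λ (hf.toLp f) = ∫ x, f x * g x ∂μ)
    {E : Set X} (hE : MeasurableSet E) {C : ℝ} (hC : 0 ≤ C) (hgC : ∀ x ∈ E, |g x| ≤ C)
    (hρC : ∀ x ∈ E, 1 ≤ C * ρ x) :
    ∫⁻ x in E, ‖g x‖ₑ ^ q ∂μ ≤ ENNReal.ofReal (‖Λ‖ ^ q) := by
  have hp0 : p ≠ 0 := (zero_lt_one.trans_le (Fact.out : 1 ≤ p)).ne'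
  have hq1 : 1 < q := hpq.symm.lt
  have hq0 : 0 < q := hpq.symm.pos
  have hpp : 0 < p.toReal := hpq.pos
  -- The extremal function in Hölder's inequality: on `E`, both `f g` and `|f|^p` equal `|g|^q`.
  let f : X → ℝ := E.indicator fun x => g x * |g x| ^ (q - 2)
  have hfm : Measurable f :=
    (hg.mul (hg.norm.pow_const (q - 2))).indicator hE
  have habs (x : X) : |g x * |g x| ^ (q - 2)| = |g x| ^ (q - 1) := by
    rcases eq_or_ne (g x) 0 with h0 | h0
    · rw [h0]; simp [Real.zero_rpow (sub_pos.2 hq1).ne']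
    · have : 0 < |g x| := abs_pos.2 h0
      rw [abs_mul, abs_of_nonneg (Real.rpow_nonneg this.le _)]
      nth_rewrite 1 [← Real.rpow_one |g x|]
      rw [← Real.rpow_add this]
      congr 1; ring
  have hfb (x : X) : |f x| ≤ C ^ (q - 1) * C * ρ x := by
    by_cases hx : x ∈ E
    · simp only [f, Set.indicator_of_mem hx, habs]
      calc |g x| ^ (q - 1) ≤ C ^ (q - 1) :=
            Real.rpow_le_rpow (abs_nonneg _) (hgC x hx) (sub_pos.2 hq1).le
        _ ≤ C ^ (q - 1) * (C * ρ x) := le_mul_of_one_le_right (by positivity) (hρC x hx)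
        _ = _ := by ring
    · simp only [f, Set.indicator_of_notMem hx, abs_zero]
      have := hρ0 x
      positivity
  have hf : MemLp f p μ := (hρ.const_mul (C ^ (q - 1) * C)).mono' hfm.aestronglyMeasurable
    (Eventually.of_forall hfb)
  have hmul (x : X) : f x * g x = E.indicator (fun x => |g x| ^ q) x := by
    by_cases hx : x ∈ E
    · simp only [f, Set.indicator_of_mem hx]
      rcases eq_or_ne (g x) 0 with h0 | h0
      · rw [h0]; simp [Real.zero_rpow hq0.ne']
      · have : 0 < |g x| := abs_pos.2 h0
        have h2 : |g x| ^ q = |g x| ^ (q - 2) * |g x| ^ (2 : ℝ) := by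
          rw [← Real.rpow_add this]; congr 1; ring
        rw [h2, Real.rpow_two, sq_abs]; ring
    · simp [f, Set.indicator_of_notMem hx]
  have hpow (x : X) : ‖f x‖ ^ p.toReal = E.indicator (fun x => |g x| ^ q) x := by
    by_cases hx : x ∈ E
    · simp only [f, Set.indicator_of_mem hx, Real.norm_eq_abs, habs]
      rw [← Real.rpow_mul (abs_nonneg _)]
      congr 1
      have := hpq.symm.sub_one_mul_conj
      linarith
    · simp [f, Set.indicator_of_notMem hx, Real.zero_rpow hpp.ne']
  have hint : Integrable (E.indicator fun x => |g x| ^ q) μ := by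
    have := hf.integrable_norm_rpow hp0 hp
    simpa only [hpow] using this
  set I : ℝ := ∫ x, E.indicator (fun x => |g x| ^ q) x ∂μ with hI
  have hI0 : 0 ≤ I := integral_nonneg fun x => Set.indicator_nonneg (fun x _ => by positivity) x
  -- Dividing by `I^{1/p}` will give `I^{1/q} ≤ ‖Λ‖`. This is legitimate since the cut-off to `E`
  -- already makes `I` a finite integral.
  have hle : I ≤ ‖Λ‖ * I ^ p.toReal⁻¹ := by
    have h1 : Λ (hf.toLp f) = I := by
      rw [hΛ f hf hfm ⟨_, hfb⟩]
      simp only [hmul, hI]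
    have h2 : ‖hf.toLp f‖ = I ^ p.toReal⁻¹ := by
      rw [Lp.norm_toLp, hf.eLpNorm_eq_integral_rpow_norm hp0 hp, ENNReal.toReal_ofReal]
      · simp only [hpow, hI]
      · positivity
    calc I = Λ (hf.toLp f) := h1.symm
      _ ≤ ‖Λ (hf.toLp f)‖ := le_abs_self _
      _ ≤ ‖Λ‖ * ‖hf.toLp f‖ := Λ.le_opNorm _
      _ = _ := by rw [h2]
  have hIq : I ≤ ‖Λ‖ ^ q := by
    rcases hI0.eq_or_lt with h0 | h0
    · rw [← h0]; positivity
    · have h1 : I ^ q⁻¹ ≤ ‖Λ‖ := by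
        have h2 : I = I ^ q⁻¹ * I ^ p.toReal⁻¹ := by
          rw [← Real.rpow_add h0, add_comm, hpq.inv_add_inv_eq_one, Real.rpow_one]
        have h3 : 0 < I ^ p.toReal⁻¹ := by positivity
        rw [h2] at hle
        nth_rewrite 2 [← h2] at hle
        exact le_of_mul_le_mul_right hle h3
      calc I = (I ^ q⁻¹) ^ q := by rw [← Real.rpow_mul hI0, inv_mul_cancel₀ hq0.ne', Real.rpow_one]
        _ ≤ _ := Real.rpow_le_rpow (by positivity) h1 hq0.le
  calc ∫⁻ x in E, ‖g x‖ₑ ^ q ∂μ = ENNReal.ofReal I := by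
        rw [hI, ofReal_integral_eq_lintegral_ofReal hint
          (Eventually.of_forall fun x => Set.indicator_nonneg (fun x _ => by positivity) x),
          ← lintegral_indicator hE]
        congr 1 with x
        by_cases hx : x ∈ E
        · simp only [Set.indicator_of_mem hx]
          rw [← ofReal_norm, ENNReal.ofReal_rpow_of_nonneg (norm_nonneg _) hq0.le,
            Real.norm_eq_abs]
        · simp [Set.indicator_of_notMem hx]
    _ ≤ _ := ENNReal.ofReal_le_ofReal hIq

/-- **Riesz representation in `L^p`**: for a `σ`-finite measure and `1 < p < ∞`, a continuous
linear functional on the real space `L^p` is integration against a function in `L^q`. -/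
theorem exists_memLp_apply_eq_integral [SigmaFinite μ] [Fact (1 ≤ p)] (hp : p ≠ ⊤) {q : ℝ}
    (hpq : p.toReal.HolderConjugate q) (Λ : Lp ℝ p μ →L[ℝ] ℝ) :
    ∃ g : X → ℝ, MemLp g (ENNReal.ofReal q) μ ∧ ∀ (f : X → ℝ) (hf : MemLp f p μ),
      Integrable (fun x => f x * g x) μ ∧ Λ (hf.toLp f) = ∫ x, f x * g x ∂μ := by
  have hp0 : p ≠ 0 := (zero_lt_one.trans_le (Fact.out : 1 ≤ p)).ne'
  have hq0 : 0 < q := hpq.symm.pos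
  obtain ⟨ρ, hρm, hρ0, hρ⟩ := exists_pos_memLp (μ := μ) hp0 hp
  obtain ⟨h, hm, hint, hset⟩ :=
    exists_integrable_setIntegral_eq hp Λ hρ fun x => (hρ0 x).le
  let g : X → ℝ := fun x => h x / ρ x
  have hg : Measurable g := hm.div hρm
  have hΛ : ∀ (f : X → ℝ) (hf : MemLp f p μ), Measurable f → (∃ C, ∀ x, |f x| ≤ C * ρ x) →
      Λ (hf.toLp f) = ∫ x, f x * g x ∂μ := by
    rintro f hf hfm ⟨C, hC⟩
    have hb (x : X) : |f x / ρ x| ≤ C := by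
      rw [abs_div, abs_of_pos (hρ0 x), div_le_iff₀ (hρ0 x)]
      exact hC x
    have key := apply_toLp_mul_eq_integral_of_abs_le hp Λ hρ (fun x => (hρ0 x).le) hint hset
      (hfm.div hρm) hb
    have e : hf.toLp f = (memLp_mul_of_abs_le hρ (hfm.div hρm) hb).toLp _ :=
      MemLp.toLp_congr _ _ (Eventually.of_forall fun x => by
        simp [div_mul_cancel₀ _ (hρ0 x).ne'])
    rw [e, key]
    congr 1 with x
    simp only [g, Pi.div_apply]
    ring
  -- On `E n` the function `g` is bounded and `ρ` is bounded below. Every point eventually lies in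
  -- `E n`, so Fatou carries the uniform bound on `∫_{E n} |g|^q` to the whole space.
  let E : ℕ → Set X := fun n => {x | |g x| ≤ n} ∩ {x | 1 ≤ n * ρ x}
  have hE (n : ℕ) : MeasurableSet (E n) :=
    (measurableSet_le hg.norm measurable_const).inter
      (measurableSet_le measurable_const (hρm.const_mul _))
  have hEx (x : X) : ∀ᶠ n in atTop, x ∈ E n := by
    have h1 : ∀ᶠ n : ℕ in atTop, |g x| ≤ n := tendsto_natCast_atTop_atTop.eventually_ge_atTop _
    have h2 : ∀ᶠ n : ℕ in atTop, (ρ x)⁻¹ ≤ n := tendsto_natCast_atTop_atTop.eventually_ge_atTop _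
    filter_upwards [h1, h2] with n hn1 hn2
    refine ⟨hn1, ?_⟩
    rw [Set.mem_ofPred_eq, ← inv_mul_cancel₀ (hρ0 x).ne']
    exact mul_le_mul_of_nonneg_right hn2 (hρ0 x).le
  have hgq : MemLp g (ENNReal.ofReal q) μ := by
    refine ⟨hg.aestronglyMeasurable, ?_⟩
    rw [eLpNorm_lt_top_iff_lintegral_rpow_enorm_lt_top (by simpa using hq0) ENNReal.ofReal_ne_top,
      ENNReal.toReal_ofReal hq0.le]
    have hle (n : ℕ) : ∫⁻ x, (E n).indicator (fun x => ‖g x‖ₑ ^ q) x ∂μ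
        ≤ ENNReal.ofReal (‖Λ‖ ^ q) := by
      rw [lintegral_indicator (hE n)]
      exact lintegral_rpow_le_of_pairing hp hpq Λ hg hρ hρ0 hΛ (hE n) n.cast_nonneg
        (fun x hx => hx.1) (fun x hx => hx.2)
    have hlim : ∀ x, liminf (fun n => (E n).indicator (fun x => ‖g x‖ₑ ^ q) x) atTop
        = ‖g x‖ₑ ^ q := fun x => by
      refine Tendsto.liminf_eq (tendsto_const_nhds.congr' ?_)
      filter_upwards [hEx x] with n hn
      rw [Set.indicator_of_mem hn]
    calc ∫⁻ x, ‖g x‖ₑ ^ q ∂μ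
        = ∫⁻ x, liminf (fun n => (E n).indicator (fun x => ‖g x‖ₑ ^ q) x) atTop ∂μ := by
          simp only [hlim]
      _ ≤ liminf (fun n => ∫⁻ x, (E n).indicator (fun x => ‖g x‖ₑ ^ q) x ∂μ) atTop :=
          lintegral_liminf_le fun n => (hg.enorm.pow_const q).indicator (hE n)
      _ ≤ ENNReal.ofReal (‖Λ‖ ^ q) := by
          refine (liminf_le_liminf (Eventually.of_forall hle)).trans ?_
          rw [liminf_const]
      _ < ⊤ := ENNReal.ofReal_lt_top
  have hprod (f : X → ℝ) (hf : MemLp f p μ) : Integrable (fun x => f x * g x) μ := by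
    have : ENNReal.HolderConjugate p (ENNReal.ofReal q) := by
      rw [← ENNReal.ofReal_toReal hp]
      exact hpq.ennrealOfReal
    exact hf.integrable_mul hgq
  refine ⟨g, hgq, fun f hf => ⟨hprod f hf, ?_⟩⟩
  obtain ⟨f', hf'm, hff'⟩ : ∃ f' : X → ℝ, Measurable f' ∧ f =ᵐ[μ] f' :=
    ⟨hf.1.mk f, hf.1.stronglyMeasurable_mk.measurable, hf.1.ae_eq_mk⟩
  have hf' : MemLp f' p μ := (memLp_congr_ae hff').1 hf
  rw [MemLp.toLp_congr hf hf' hff',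
    integral_congr_ae (hff'.mono fun x hx => show f x * g x = f' x * g x by rw [hx])]
  -- Truncation to `A n` yields functions bounded by a multiple of `ρ`, for which the representation
  -- is known.
  let A : ℕ → Set X := fun n => {x | |f' x| ≤ n * ρ x}
  have hA (n : ℕ) : MeasurableSet (A n) := measurableSet_le hf'm.norm (hρm.const_mul _)
  have hAx (x : X) : ∀ᶠ n in atTop, (A n).indicator f' x = f' x := by
    have h2 : ∀ᶠ n : ℕ in atTop, |f' x| / ρ x ≤ n :=
      tendsto_natCast_atTop_atTop.eventually_ge_atTop _
    filter_upwards [h2] with n hn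
    exact Set.indicator_of_mem (by rwa [Set.mem_ofPred_eq, ← div_le_iff₀ (hρ0 x)]) _
  have hAlim (x : X) : Tendsto (fun n => (A n).indicator f' x) atTop (𝓝 (f' x)) :=
    tendsto_const_nhds.congr' ((hAx x).mono fun n hn => hn.symm)
  have hAle (n : ℕ) (x : X) : |(A n).indicator f' x| ≤ |f' x| := norm_indicator_le_norm_self f' x
  have l1 : Tendsto (fun n => Λ ((hf'.indicator (hA n)).toLp _)) atTop (𝓝 (Λ (hf'.toLp f'))) :=
    (Λ.continuous.tendsto _).comp
      (tendsto_toLp_of_dominated hp (fun n => hf'.indicator (hA n)) hf' hf'.norm hAle hAlim)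
  have e (n : ℕ) : Λ ((hf'.indicator (hA n)).toLp _) = ∫ x, (A n).indicator f' x * g x ∂μ := by
    refine hΛ _ _ (hf'm.indicator (hA n)) ⟨n, fun x => ?_⟩
    by_cases hx : x ∈ A n
    · rw [Set.indicator_of_mem hx]; exact hx
    · rw [Set.indicator_of_notMem hx, abs_zero]
      have := hρ0 x
      positivity
  have l2 : Tendsto (fun n => ∫ x, (A n).indicator f' x * g x ∂μ) atTop
      (𝓝 (∫ x, f' x * g x ∂μ)) := by
    refine tendsto_integral_of_dominated_convergence (fun x => ‖f' x * g x‖) ?_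
      (hprod f' hf').norm ?_ ?_
    · exact fun n => ((hf'm.indicator (hA n)).mul hg).aestronglyMeasurable
    · refine fun n => Eventually.of_forall fun x => ?_
      rw [norm_mul, norm_mul]
      exact mul_le_mul_of_nonneg_right (hAle n x) (norm_nonneg _)
    · exact Eventually.of_forall fun x => (hAlim x).mul_const _
  simp only [e] at l1
  exact tendsto_nhds_unique l1 l2

end LpDual

/-! ### Radial mollifiers and distributionally harmonic functions -/

section Radial

variable {E : Type*} [NormedAddCommGroup E] [InnerProductSpace ℝ E] [FiniteDimensional ℝ E]

open Module Laplacian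

/-- The Laplacian of a radial function, written in terms of the squared distance to the center. -/
theorem laplacian_comp_norm_sub_sq {F : ℝ → ℝ} (hF : ContDiff ℝ 2 F) (y x : E) :
    Δ (fun z : E => F (‖z - y‖ ^ 2)) x =
      2 * finrank ℝ E * deriv F (‖x - y‖ ^ 2)
        + 4 * ‖x - y‖ ^ 2 * deriv (deriv F) (‖x - y‖ ^ 2) := by
  obtain ⟨B, hB⟩ : ∃ B : E →L[ℝ] E →L[ℝ] ℝ, ∀ z w, B z w = inner ℝ z w :=
    ⟨innerSL ℝ, fun z w => rfl⟩
  have hsq (z : E) : HasFDerivAt (fun z : E => ‖z - y‖ ^ 2) ((2 : ℝ) • B (z - y)) z := by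
    have := ((hasFDerivAt_id z).sub_const y).norm_sq
    refine this.congr_fderiv ?_
    ext w
    simp [hB, two_mul]
  have hF1 : Differentiable ℝ F := hF.differentiable (by norm_num)
  have hF2 : Differentiable ℝ (deriv F) :=
    ((contDiff_succ_iff_deriv (n := 1)).1 hF).2.2.differentiable (by norm_num)
  have h1 : fderiv ℝ (fun z : E => F (‖z - y‖ ^ 2)) =
      fun z => (2 * deriv F (‖z - y‖ ^ 2)) • B (z - y) := by
    ext1 z
    have := ((hF1 (‖z - y‖ ^ 2)).hasDerivAt.comp_hasFDerivAt z (hsq z)).fderiv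
    rw [Function.comp_def] at this
    rw [this, smul_smul, mul_comm]
  let c : E →L[ℝ] ℝ := (2 : ℝ) • (deriv (deriv F) (‖x - y‖ ^ 2) • ((2 : ℝ) • B (x - y)))
  have hc : HasFDerivAt (fun z : E => 2 * deriv F (‖z - y‖ ^ 2)) c x := by
    have := ((hF2 (‖x - y‖ ^ 2)).hasDerivAt.comp_hasFDerivAt x (hsq x)).const_mul (2 : ℝ)
    exact this
  have hBx : HasFDerivAt (fun z : E => B (z - y)) B x := by
    have := B.hasFDerivAt.comp x ((hasFDerivAt_id x).sub_const y)
    simpa [Function.comp_def] using this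
  have h2 := (hc.smul hBx).fderiv
  rw [InnerProductSpace.laplacian_eq_iteratedFDeriv_stdOrthonormalBasis]
  have hsum := (stdOrthonormalBasis ℝ E).sum_sq_inner_right (x - y)
  have hterm (i : Fin (finrank ℝ E)) :
      iteratedFDeriv ℝ 2 (fun z : E => F (‖z - y‖ ^ 2)) x
        ![stdOrthonormalBasis ℝ E i, stdOrthonormalBasis ℝ E i] =
      2 * deriv F (‖x - y‖ ^ 2) + 4 * deriv (deriv F) (‖x - y‖ ^ 2) *
        inner ℝ (stdOrthonormalBasis ℝ E i) (x - y) ^ 2 := by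
    rw [iteratedFDeriv_two_apply, h1]
    erw [h2]
    simp [c, hB, inner_sub_right, real_inner_comm]
    ring
  simp only [hterm, Finset.sum_add_distrib, ← Finset.mul_sum, hsum]
  simp
  ring

/-- A smooth profile, constant to the right of `1`, with nonnegative derivative. -/
theorem exists_smooth_profile : ∃ H : ℝ → ℝ, ContDiff ℝ ((⊤ : ℕ∞) : WithTop ℕ∞) H ∧
    (∀ s, 1 ≤ s → H s = 0) ∧ (∀ s, 0 ≤ deriv H s) ∧ 0 < deriv H 0 := by
  have hd (s : ℝ) : HasDerivAt (fun s => -expNegInvGlue (1 - s))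
      (deriv expNegInvGlue (1 - s)) s := by
    have h1 : DifferentiableAt ℝ expNegInvGlue (1 - s) :=
      (expNegInvGlue.contDiff (n := 1)).differentiable (by norm_num) _
    refine (h1.hasDerivAt.comp s ((hasDerivAt_id s).const_sub 1)).neg.congr_deriv ?_
    simp
  -- The two sign changes make the function increasing. Its derivative, not the function itself,
  -- will serve as averaging kernel.
  refine ⟨fun s => -expNegInvGlue (1 - s), ?_, ?_, ?_, ?_⟩
  · exact (expNegInvGlue.contDiff.comp (contDiff_const.sub contDiff_id)).neg
  · intro s hs
    simp [expNegInvGlue.zero_of_nonpos (sub_nonpos.2 hs)]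
  · intro s
    rw [(hd s).deriv]
    exact expNegInvGlue.monotone.deriv_nonneg
  · rw [(hd 0).deriv]
    have := expNegInvGlue.hasDerivAt_polynomial_eval_inv_mul 1 1
    simp only [Polynomial.eval_one, one_mul] at this
    rw [sub_zero, this.deriv]
    simpa using expNegInvGlue.pos_of_pos one_pos

theorem exists_abs_le_of_eq_zero_of_one_lt {f : ℝ → ℝ} (hf : Continuous f)
    (h0 : ∀ s, 1 < s → f s = 0) : ∃ C, 0 ≤ C ∧ ∀ s, 0 ≤ s → |f s| ≤ C := by
  obtain ⟨C, hC⟩ := isCompact_Icc.exists_bound_of_continuousOn (s := Set.Icc (0 : ℝ) 1)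
    hf.continuousOn
  refine ⟨C, (abs_nonneg _).trans (hC 0 (by simp)), fun s hs => ?_⟩
  rcases le_or_gt s 1 with h | h
  · exact hC s ⟨hs, h⟩
  · rw [h0 s h, abs_zero]
    exact (abs_nonneg _).trans (hC 0 (by simp))

theorem deriv_eq_zero_of_eq_zero_of_one_lt {f : ℝ → ℝ} (h0 : ∀ s, 1 < s → f s = 0) (s : ℝ)
    (hs : 1 < s) : deriv f s = 0 := by
  have : f =ᶠ[𝓝 s] fun _ => 0 := by
    filter_upwards [lt_mem_nhds hs] with t ht using h0 t ht
  rw [this.deriv_eq, deriv_const]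

variable [MeasurableSpace E] [BorelSpace E]

theorem integral_fderiv_apply_eq_zero {G : Type*} [NormedAddCommGroup G] [NormedSpace ℝ G]
    {g : E → G} (hg : ContDiff ℝ 1 g) (hc : HasCompactSupport g) (v : E) :
    ∫ x, fderiv ℝ g x v = 0 := by
  have hcont : Continuous fun x => fderiv ℝ g x v :=
    (hg.continuous_fderiv (by norm_num)).clm_apply continuous_const
  have hi1 : Integrable fun x => fderiv ℝ g x v :=
    hcont.integrable_of_hasCompactSupport (hc.fderiv_apply (𝕜 := ℝ) v)
  have hi2 : Integrable g := hg.continuous.integrable_of_hasCompactSupport hc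
  -- Integration by parts against the constant function `1`.
  have := integral_smul_fderiv_eq_neg_fderiv_smul_of_integrable (μ := (volume : Measure E))
    (f := fun _ : E => (1 : ℝ)) (g := g) (v := v) (by simp)
    (by simpa using hi1) (by simpa using hi2) (fun x _ => by fun_prop)
    (fun x _ => hg.differentiable (by norm_num) x)
  simpa using this

theorem integral_laplacian_eq_zero {G : Type*} [NormedAddCommGroup G] [NormedSpace ℝ G]
    {u : E → G} (hu : ContDiff ℝ 2 u) (hc : HasCompactSupport u) :
    ∫ x, Δ u x = 0 := by
  rw [InnerProductSpace.laplacian_eq_iteratedFDeriv_stdOrthonormalBasis]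
  simp only [iteratedFDeriv_two_apply]
  have hu1 : ContDiff ℝ 1 (fderiv ℝ u) := hu.fderiv_right (by norm_num)
  have hap (v : E) : ContDiff ℝ 1 fun x => fderiv ℝ u x v := hu1.clm_apply contDiff_const
  have hcv (v : E) : HasCompactSupport fun x => fderiv ℝ u x v := hc.fderiv_apply (𝕜 := ℝ) v
  have heq (v x : E) : fderiv ℝ (fderiv ℝ u) x v v = fderiv ℝ (fun x => fderiv ℝ u x v) x v := by
    rw [fderiv_clm_apply (hu1.differentiable (by norm_num) x) (by fun_prop)]
    simp
  have hint (v : E) : Integrable fun x => fderiv ℝ (fderiv ℝ u) x v v := by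
    simp only [heq]
    exact (((hap v).continuous_fderiv (by norm_num)).clm_apply
      continuous_const).integrable_of_hasCompactSupport ((hcv v).fderiv_apply (𝕜 := ℝ) v)
  rw [integral_finsetSum _ fun i _ => by simpa using hint _]
  refine Finset.sum_eq_zero fun i _ => ?_
  simp only [Matrix.cons_val_zero, Matrix.cons_val_one, heq]
  exact integral_fderiv_apply_eq_zero (hap _) (hcv _) _

/-- The weighted mean of `v` around `y` at scale `1 / k`, with the radial weight
`x ↦ k ^ d * η (k ^ 2 * ‖x‖ ^ 2)`. -/
noncomputable def radialMean (η : ℝ → ℝ) (v : E → ℝ) (y : E) (k : ℝ) : ℝ :=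
  ∫ x, k ^ finrank ℝ E * η (k ^ 2 * ‖x - y‖ ^ 2) * v x

/-- Differentiation under the integral. For `k` in `(k₀/2, 2k₀)` all kernels live in the ball of
radius `2/k₀`, where `v` is integrable and `M |v|` dominates the derivative. -/
theorem hasDerivAt_radialMean {η : ℝ → ℝ} (hη : ContDiff ℝ 1 η) (hη0 : ∀ s, 1 < s → η s = 0)
    {v : E → ℝ} (hv : LocallyIntegrable v) (y : E) {k₀ : ℝ} (hk₀ : 0 < k₀) :
    HasDerivAt (radialMean η v y)
      (∫ x, (finrank ℝ E * k₀ ^ (finrank ℝ E - 1) * η (k₀ ^ 2 * ‖x - y‖ ^ 2) +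
        k₀ ^ finrank ℝ E * (deriv η (k₀ ^ 2 * ‖x - y‖ ^ 2) * (2 * k₀ * ‖x - y‖ ^ 2))) * v x) k₀ := by
  set d := finrank ℝ E with hd
  have hη'0 := deriv_eq_zero_of_eq_zero_of_one_lt hη0
  have hη'c : Continuous (deriv η) := hη.continuous_deriv (by norm_num)
  obtain ⟨A, hA0, hA⟩ := exists_abs_le_of_eq_zero_of_one_lt hη.continuous hη0
  obtain ⟨B, hB0, hB⟩ := exists_abs_le_of_eq_zero_of_one_lt hη'c hη'0
  have hηc := hη.continuous
  let F' : ℝ → E → ℝ := fun k x => (d * k ^ (d - 1) * η (k ^ 2 * ‖x - y‖ ^ 2) +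
        k ^ d * (deriv η (k ^ 2 * ‖x - y‖ ^ 2) * (2 * k * ‖x - y‖ ^ 2))) * v x
  let M : ℝ := d * (2 * k₀) ^ (d - 1) * A +
    (2 * k₀) ^ d * (B * (2 * (2 * k₀) * (2 / k₀) ^ 2))
  have hfar {k : ℝ} {x : E} (hk : k₀ / 2 < k) (hx : x ∉ Metric.closedBall y (2 / k₀)) :
      1 < k ^ 2 * ‖x - y‖ ^ 2 := by
    rw [Metric.mem_closedBall, dist_eq_norm, not_le] at hx
    rw [← mul_pow]
    refine one_lt_pow₀ ?_ two_ne_zero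
    calc (1 : ℝ) = k₀ / 2 * (2 / k₀) := by field_simp
      _ < k * ‖x - y‖ := mul_lt_mul hk hx.le (by positivity) (by linarith [half_pos hk₀])
  have hmeas : AEStronglyMeasurable v := hv.aestronglyMeasurable
  have hvi : IntegrableOn v (Metric.closedBall y (2 / k₀)) :=
    hv.integrableOn_isCompact (isCompact_closedBall _ _)
  refine (hasDerivAt_integral_of_dominated_loc_of_deriv_le (𝕜 := ℝ) (μ := (volume : Measure E))
    (F := fun k x => k ^ d * η (k ^ 2 * ‖x - y‖ ^ 2) * v x) (F' := F') (x₀ := k₀)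
    (s := Set.Ioo (k₀ / 2) (2 * k₀))
    (bound := (Metric.closedBall y (2 / k₀)).indicator fun x => M * ‖v x‖)
    (Ioo_mem_nhds (by linarith) (by linarith)) ?_ ?_ ?_ ?_ ?_ ?_).2
  · refine Eventually.of_forall fun k => ?_
    exact (Continuous.aestronglyMeasurable (by fun_prop)).mul hmeas
  · refine ((integrable_indicator_iff measurableSet_closedBall).2
      (hvi.norm.const_mul (k₀ ^ d * A))).mono'
      ((Continuous.aestronglyMeasurable (by fun_prop)).mul hmeas)
      (Eventually.of_forall fun x => ?_)
    by_cases hx : x ∈ Metric.closedBall y (2 / k₀)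
    · rw [Set.indicator_of_mem hx, norm_mul, norm_mul, Real.norm_of_nonneg (by positivity)]
      gcongr
      exact hA _ (by positivity)
    · rw [hη0 _ (hfar (by linarith) hx)]
      simp [hx]
  · exact (Continuous.aestronglyMeasurable (by fun_prop)).mul hmeas
  · refine Eventually.of_forall fun x k hk => ?_
    have hk0 : 0 < k := by linarith [hk.1, half_pos hk₀]
    by_cases hx : x ∈ Metric.closedBall y (2 / k₀)
    · rw [Set.indicator_of_mem hx, norm_mul]
      refine mul_le_mul_of_nonneg_right ?_ (norm_nonneg _)
      rw [Metric.mem_closedBall, dist_eq_norm] at hx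
      refine (norm_add_le _ _).trans (add_le_add ?_ ?_)
      · rw [norm_mul, Real.norm_of_nonneg (by positivity)]
        have := hk.2.le
        gcongr
        exact hA _ (by positivity)
      · have := hk.2.le
        rw [norm_mul, norm_mul, Real.norm_of_nonneg (by positivity : 0 ≤ k ^ d),
          Real.norm_of_nonneg (by positivity : 0 ≤ 2 * k * ‖x - y‖ ^ 2)]
        gcongr
        exact hB _ (by positivity)
    · have h1 := hfar hk.1 hx
      simp [F', hη0 _ h1, hη'0 _ h1, hx]
  · exact (integrable_indicator_iff measurableSet_closedBall).2 (hvi.norm.const_mul M)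
  · refine Eventually.of_forall fun x k hk => ?_
    refine HasDerivAt.mul_const ?_ _
    have h1 : HasDerivAt (fun k : ℝ => k ^ d) (d * k ^ (d - 1)) k := hasDerivAt_pow d k
    have h2 : HasDerivAt (fun k : ℝ => k ^ 2 * ‖x - y‖ ^ 2) (2 * k * ‖x - y‖ ^ 2) k := by
      simpa using (hasDerivAt_pow 2 k).mul_const (‖x - y‖ ^ 2)
    have h3 := (hη.differentiable (by norm_num) (k ^ 2 * ‖x - y‖ ^ 2)).hasDerivAt.comp k h2
    exact h1.mul h3

/-- Radial means of a distributionally harmonic function do not depend on the scale. -/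
theorem radialMean_eq_of_weakly_harmonic {H : ℝ → ℝ}
    (hH : ContDiff ℝ ((⊤ : ℕ∞) : WithTop ℕ∞) H) (hH0 : ∀ s, 1 < s → H s = 0)
    {v : E → ℝ} (hv : LocallyIntegrable v)
    (hharm : ∀ u : E → ℝ, ContDiff ℝ ((⊤ : ℕ∞) : WithTop ℕ∞) u → HasCompactSupport u →
      ∫ x, Δ u x * v x = 0) (y : E) {k l : ℝ} (hk : 0 < k) (hl : 0 < l) :
    radialMean (deriv H) v y k = radialMean (deriv H) v y l := by
  have hη : ContDiff ℝ ((⊤ : ℕ∞) : WithTop ℕ∞) (deriv H) :=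
    (contDiff_infty_iff_deriv.1 hH).2
  have hη0 := deriv_eq_zero_of_eq_zero_of_one_lt hH0
  have hder (k : ℝ) (hk : 0 < k) := hasDerivAt_radialMean (hη.of_le (by norm_cast))
    hη0 hv y hk
  have hzero (k : ℝ) (hk : 0 < k) : deriv (radialMean (deriv H) v y) k = 0 := by
    rw [(hder k hk).deriv]
    -- The test function is `u z = H (k² |z - y|²)`. With `η = H'` and `r = |x - y|`, the derivative
    -- of `k^d η(k² r²)` in `k` is `k^d / (2k³)` times `Δu`, by the radial formula for the
    -- Laplacian.
    let F : ℝ → ℝ := fun s => H (k ^ 2 * s)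
    have hF : ContDiff ℝ ((⊤ : ℕ∞) : WithTop ℕ∞) F := hH.comp (contDiff_const.mul contDiff_id)
    have hF1 : deriv F = fun s => k ^ 2 * deriv H (k ^ 2 * s) := by
      ext s
      exact deriv_comp_mul_left (k ^ 2) H s
    have hF2 : deriv (deriv F) = fun s => k ^ 4 * deriv (deriv H) (k ^ 2 * s) := by
      rw [hF1]
      ext s
      rw [deriv_const_mul_field, deriv_comp_mul_left (k ^ 2) (deriv H) s, smul_eq_mul]
      ring
    have hu : ContDiff ℝ ((⊤ : ℕ∞) : WithTop ℕ∞) fun z : E => F (‖z - y‖ ^ 2) :=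
      hF.comp ((contDiff_id.sub contDiff_const).norm_sq ℝ)
    have huc : HasCompactSupport fun z : E => F (‖z - y‖ ^ 2) := by
      refine HasCompactSupport.intro (isCompact_closedBall y k⁻¹) fun x hx => hH0 _ ?_
      rw [Metric.mem_closedBall, dist_eq_norm, not_le, inv_lt_iff_one_lt_mul₀ hk] at hx
      rw [← mul_pow, mul_comm]
      exact one_lt_pow₀ hx two_ne_zero
    have h0 := hharm _ hu huc
    have hpt (x : E) : (finrank ℝ E * k ^ (finrank ℝ E - 1) * deriv H (k ^ 2 * ‖x - y‖ ^ 2) +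
        k ^ finrank ℝ E * (deriv (deriv H) (k ^ 2 * ‖x - y‖ ^ 2) * (2 * k * ‖x - y‖ ^ 2))) * v x =
        k ^ finrank ℝ E / (2 * k ^ 3) * (Δ (fun z : E => F (‖z - y‖ ^ 2)) x * v x) := by
      rw [laplacian_comp_norm_sub_sq (hF.of_le (by norm_cast)), hF2, hF1]
      -- The exponent `d - 1` is truncated at `d = 0`, where its coefficient `d` vanishes anyway.
      rcases Nat.eq_zero_or_pos (finrank ℝ E) with hd | hd
      · rw [hd]; field_simp; simp; ring
      · obtain ⟨d, hd'⟩ := Nat.exists_eq_succ_of_ne_zero hd.ne'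
        rw [hd']
        simp only [Nat.succ_eq_add_one, Nat.add_sub_cancel]
        field_simp
        push_cast
        ring
    simp only [hpt, integral_const_mul, h0, mul_zero]
  exact isOpen_Ioi.is_const_of_deriv_eq_zero isPreconnected_Ioi
    (fun k hk => (hder k hk).differentiableAt.differentiableWithinAt) (fun k hk => hzero k hk) hk hl

end Radial

/-! ### Limits of radial means at small and large scales, and the Liouville theorem. -/

section RadialLimits

theorem one_lt_sq_mul_norm_sub_sq {E : Type*} [SeminormedAddCommGroup E] {k : ℝ} (hk : 0 < k)
    {x y : E} (hx : x ∉ Metric.closedBall y k⁻¹) : 1 < k ^ 2 * ‖x - y‖ ^ 2 := by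
  rw [Metric.mem_closedBall, dist_eq_norm, not_le, inv_lt_iff_one_lt_mul₀ hk] at hx
  rw [← mul_pow, mul_comm]
  exact one_lt_pow₀ hx two_ne_zero

variable {E : Type*} [NormedAddCommGroup E] [InnerProductSpace ℝ E] [FiniteDimensional ℝ E]
  [MeasurableSpace E] [BorelSpace E]

open Module

theorem integral_radial_scale (η : ℝ → ℝ) (y : E) {k : ℝ} (hk : 0 < k) :
    ∫ x : E, k ^ finrank ℝ E * η (k ^ 2 * ‖x - y‖ ^ 2) = ∫ x : E, η (‖x‖ ^ 2) := by
  rw [integral_const_mul, integral_sub_right_eq_self (fun x : E => η (k ^ 2 * ‖x‖ ^ 2)) y]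
  have h := Measure.integral_comp_smul (volume : Measure E) (fun x : E => η (‖x‖ ^ 2)) k
  simp only [norm_smul, mul_pow, Real.norm_eq_abs, sq_abs] at h
  rw [h, abs_of_pos (by positivity), smul_eq_mul, mul_inv_cancel_left₀ (by positivity)]

theorem pow_mul_measureReal_closedBall_inv (y : E) {k : ℝ} (hk : 0 < k) :
    k ^ finrank ℝ E * volume.real (Metric.closedBall y k⁻¹) =
      volume.real (Metric.ball (0 : E) 1) := by
  rw [measureReal_def, Measure.addHaar_closedBall _ _ (by positivity), ENNReal.toReal_mul,
    ENNReal.toReal_ofReal (by positivity), ← mul_assoc, inv_pow, mul_inv_cancel₀ (by positivity),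
    one_mul, measureReal_def]

/-- Radial means at small scales recover a locally integrable function almost everywhere. -/
theorem ae_tendsto_radialMean_atTop {η : ℝ → ℝ} (hη : Continuous η) (hη0 : ∀ s, 1 < s → η s = 0)
    (hc : ∫ x : E, η (‖x‖ ^ 2) ≠ 0) {v : E → ℝ} (hv : LocallyIntegrable v) :
    ∀ᵐ y : E, Tendsto (radialMean η v y) atTop (𝓝 ((∫ x : E, η (‖x‖ ^ 2)) * v y)) := by
  set c := ∫ x : E, η (‖x‖ ^ 2)
  obtain ⟨A, hA0, hA⟩ := exists_abs_le_of_eq_zero_of_one_lt hη hη0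
  filter_upwards [(Besicovitch.vitaliFamily (volume : Measure E)).ae_tendsto_average_norm_sub hv]
    with y hy
  have hlim : Tendsto (fun k : ℝ => k⁻¹) atTop (𝓝[>] 0) := tendsto_inv_atTop_nhdsGT_zero
  have h1 := (hy.comp (Besicovitch.tendsto_filterAt volume y)).comp hlim
  have hvol : 0 < volume.real (Metric.ball (0 : E) 1) :=
    ENNReal.toReal_pos (Metric.measure_ball_pos _ _ one_pos).ne' measure_ball_lt_top.ne
  -- The differentiation theorem for approximate identities wants kernels of integral tending to
  -- `1`, hence the normalization by `c⁻¹`.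
  have key := tendsto_integral_smul_of_tendsto_average_norm_sub
    (g := fun (k : ℝ) (x : E) => c⁻¹ * (k ^ finrank ℝ E * η (k ^ 2 * ‖x - y‖ ^ 2)))
    (|c⁻¹| * A * volume.real (Metric.ball (0 : E) 1)) h1 ?_ ?_ ?_ ?_
  · have h2 := key.const_mul c
    refine h2.congr' ?_
    filter_upwards with k
    rw [radialMean, ← integral_const_mul]
    congr 1 with x
    rw [smul_eq_mul]
    field_simp
  · exact Eventually.of_forall fun k => hv.integrableOn_isCompact (isCompact_closedBall _ _)
  · refine tendsto_const_nhds.congr' ?_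
    filter_upwards [eventually_gt_atTop 0] with k hk
    rw [integral_const_mul, integral_radial_scale η y hk, inv_mul_cancel₀ hc]
  · filter_upwards [eventually_gt_atTop 0] with k hk x hx
    by_contra hx'
    exact hx (by simp [hη0 _ (one_lt_sq_mul_norm_sub_sq hk hx')])
  · filter_upwards [eventually_gt_atTop 0] with k hk x
    have hb : 0 < volume.real (Metric.closedBall y k⁻¹) := by
      have := pow_mul_measureReal_closedBall_inv y hk
      by_contra h
      have h0 : volume.real (Metric.closedBall y k⁻¹) = 0 :=
        le_antisymm (not_lt.1 h) measureReal_nonneg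
      rw [h0, mul_zero] at this
      exact hvol.ne this
    rw [← pow_mul_measureReal_closedBall_inv y hk, abs_mul, abs_mul,
      abs_of_nonneg (by positivity : 0 ≤ k ^ finrank ℝ E), ← mul_assoc (|c⁻¹| * A),
      mul_div_assoc, div_self hb.ne', mul_one, mul_assoc, mul_comm A]
    gcongr
    exact hA _ (by positivity)

theorem one_add_rpow_le {t R α : ℝ} (ht : 0 ≤ t) (hR : 1 ≤ R) (htR : t ≤ R) (hα : 0 ≤ α) :
    1 + t ^ α ≤ 2 * R ^ α := by
  have h1 : t ^ α ≤ R ^ α := Real.rpow_le_rpow ht htR hα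
  have h2 : 1 ≤ R ^ α := Real.one_le_rpow hR hα
  linarith

/-- The critical relation `α q = d` enters here: it yields a majorant independent of `k`, while for
fixed `x` the factor `k^d` tends to zero because `d > 0`. -/
theorem tendsto_pow_mul_setIntegral_zero {q α : ℝ} (hq : 0 < q) (hd : 0 < finrank ℝ E)
    (hα : α * q = finrank ℝ E) {g : E → ℝ} (hg : MemLp g (ENNReal.ofReal q)) (y : E) :
    Tendsto (fun k : ℝ => k ^ finrank ℝ E *
      ∫ x in Metric.closedBall y k⁻¹, |(1 + ‖x‖ ^ α) * g x| ^ q) (𝓝[>] 0) (𝓝 0) := by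
  have hα0 : 0 ≤ α := nonneg_of_mul_nonneg_left (hα ▸ Nat.cast_nonneg _) hq
  have hgi : Integrable fun x => ‖g x‖ ^ q := by
    have := hg.integrable_norm_rpow (by simpa using hq) ENNReal.ofReal_ne_top
    rwa [ENNReal.toReal_ofReal hq.le] at this
  have hw : Continuous fun x : E => 1 + ‖x‖ ^ α :=
    continuous_const.add (continuous_norm.rpow_const fun _ => Or.inr hα0)
  have hvm : AEStronglyMeasurable fun x : E => |(1 + ‖x‖ ^ α) * g x| ^ q :=
    ((hw.aestronglyMeasurable.mul hg.1).norm.aemeasurable.pow_const q).aestronglyMeasurable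
  have key : Tendsto (fun k : ℝ => ∫ x, k ^ finrank ℝ E *
      (Metric.closedBall y k⁻¹).indicator (fun x => |(1 + ‖x‖ ^ α) * g x| ^ q) x) (𝓝[>] 0)
      (𝓝 (∫ _ : E, (0 : ℝ))) := by
    refine tendsto_integral_filter_of_dominated_convergence
      (fun x => 2 ^ q * (‖y‖ + 1) ^ finrank ℝ E * ‖g x‖ ^ q) ?_ ?_ (hgi.const_mul _) ?_
    · exact Eventually.of_forall fun k =>
        (hvm.indicator measurableSet_closedBall).const_mul _
    · filter_upwards [Ioc_mem_nhdsGT one_pos] with k hk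
      have hk0 : 0 < k := hk.1
      refine Eventually.of_forall fun x => ?_
      rw [norm_mul, Real.norm_of_nonneg (by positivity : 0 ≤ k ^ finrank ℝ E)]
      by_cases hx : x ∈ Metric.closedBall y k⁻¹
      · rw [Set.indicator_of_mem hx, Real.norm_of_nonneg (by positivity)]
        rw [Metric.mem_closedBall, dist_eq_norm] at hx
        have hki : 1 ≤ k⁻¹ := (one_le_inv₀ hk0).2 hk.2
        have hxn : ‖x‖ ≤ (‖y‖ + 1) * k⁻¹ := by
          have h1 : ‖x‖ ≤ ‖y‖ + ‖x - y‖ := by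
            simpa using norm_add_le y (x - y)
          have h2 : ‖y‖ ≤ ‖y‖ * k⁻¹ := le_mul_of_one_le_right (norm_nonneg _) hki
          linarith
        have hR : 1 ≤ (‖y‖ + 1) * k⁻¹ :=
          one_le_mul_of_one_le_of_one_le (by linarith [norm_nonneg y]) hki
        have hwle := one_add_rpow_le (norm_nonneg x) hR hxn hα0
        have hw0 : 0 ≤ 1 + ‖x‖ ^ α := by positivity
        -- Since `α q = d`, the growth of the weight is a constant times `k^{-d}`, which the
        -- prefactor `k^d` cancels.
        have hwq : (1 + ‖x‖ ^ α) ^ q ≤ 2 ^ q * ((‖y‖ + 1) * k⁻¹) ^ finrank ℝ E := by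
          calc (1 + ‖x‖ ^ α) ^ q ≤ (2 * ((‖y‖ + 1) * k⁻¹) ^ α) ^ q :=
                Real.rpow_le_rpow hw0 hwle hq.le
            _ = _ := by
                rw [Real.mul_rpow (by norm_num) (by positivity), ← Real.rpow_mul (by positivity),
                  hα, Real.rpow_natCast]
        rw [abs_mul, abs_of_nonneg hw0, Real.mul_rpow hw0 (abs_nonneg _)]
        calc k ^ finrank ℝ E * ((1 + ‖x‖ ^ α) ^ q * |g x| ^ q)
            ≤ k ^ finrank ℝ E * (2 ^ q * ((‖y‖ + 1) * k⁻¹) ^ finrank ℝ E * |g x| ^ q) := by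
              gcongr
          _ = 2 ^ q * (‖y‖ + 1) ^ finrank ℝ E * ‖g x‖ ^ q := by
              rw [mul_pow, inv_pow, Real.norm_eq_abs]
              field_simp
      · rw [Set.indicator_of_notMem hx, norm_zero, mul_zero]
        positivity
    · refine Eventually.of_forall fun x => ?_
      have h1 : Tendsto (fun k : ℝ => k ^ finrank ℝ E * |(1 + ‖x‖ ^ α) * g x| ^ q) (𝓝[>] 0)
          (𝓝 0) := by
        have h2 : Tendsto (fun k : ℝ => k ^ finrank ℝ E * |(1 + ‖x‖ ^ α) * g x| ^ q) (𝓝 0)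
            (𝓝 ((0 : ℝ) ^ finrank ℝ E * |(1 + ‖x‖ ^ α) * g x| ^ q)) :=
          ((continuous_pow _).mul continuous_const).tendsto 0
        rw [zero_pow hd.ne', zero_mul] at h2
        exact h2.mono_left nhdsWithin_le_nhds
      refine squeeze_zero' ?_ ?_ h1
      · filter_upwards [self_mem_nhdsWithin] with k hk
        have : 0 < k := hk
        exact mul_nonneg (by positivity)
          (Set.indicator_nonneg (fun x _ => by positivity) x)
      · filter_upwards [self_mem_nhdsWithin] with k hk
        have : 0 < k := hk
        refine mul_le_mul_of_nonneg_left ?_ (by positivity)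
        exact Set.indicator_le_self' (fun x _ => by positivity) x
  simp only [integral_const_mul, integral_indicator measurableSet_closedBall, integral_zero] at key
  exact key

/-- In the critical case, radial means at large scales vanish in the limit. -/
theorem tendsto_radialMean_zero {η : ℝ → ℝ} (hη : Continuous η) (hη0 : ∀ s, 1 < s → η s = 0)
    {p q α : ℝ} (hpq : p.HolderConjugate q) (hd : 0 < finrank ℝ E)
    (hα : α * q = finrank ℝ E) {g : E → ℝ} (hg : MemLp g (ENNReal.ofReal q)) (y : E) :
    Tendsto (radialMean η (fun x => (1 + ‖x‖ ^ α) * g x) y) (𝓝[>] 0) (𝓝 0) := by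
  have hq : 0 < q := hpq.symm.pos
  have hp : 0 < p := hpq.pos
  have hα0 : 0 ≤ α := nonneg_of_mul_nonneg_left (hα ▸ Nat.cast_nonneg _) hq
  set v : E → ℝ := fun x => (1 + ‖x‖ ^ α) * g x with hvdef
  have hw : Continuous fun x : E => 1 + ‖x‖ ^ α :=
    continuous_const.add (continuous_norm.rpow_const fun _ => Or.inr hα0)
  have hvm : AEStronglyMeasurable v := hw.aestronglyMeasurable.mul hg.1
  obtain ⟨A, hA0, hA⟩ := exists_abs_le_of_eq_zero_of_one_lt hη hη0
  set I : ℝ → ℝ := fun k => k ^ finrank ℝ E * ∫ x in Metric.closedBall y k⁻¹, |v x| ^ q with hI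
  set V := volume.real (Metric.ball (0 : E) 1) with hV
  have hIlim : Tendsto I (𝓝[>] 0) (𝓝 0) := tendsto_pow_mul_setIntegral_zero hq hd hα hg y
  have hbound : Tendsto (fun k => A * (V ^ (1 / p) * I k ^ (1 / q))) (𝓝[>] 0) (𝓝 0) := by
    have h1 := hIlim.rpow_const (p := 1 / q) (Or.inr (by positivity))
    rw [Real.zero_rpow (by positivity)] at h1
    simpa using (h1.const_mul (V ^ (1 / p))).const_mul A
  refine squeeze_zero_norm' ?_ hbound
  filter_upwards [self_mem_nhdsWithin] with k hk
  have hk0 : 0 < k := hk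
  have hvq : MemLp (fun x => |v x|) (ENNReal.ofReal q)
      (volume.restrict (Metric.closedBall y k⁻¹)) := by
    obtain ⟨C, hC⟩ := (isCompact_closedBall y k⁻¹).exists_bound_of_continuousOn hw.continuousOn
    refine (hg.restrict _).of_le_mul (c := C) hvm.restrict.norm ?_
    filter_upwards [ae_restrict_mem measurableSet_closedBall] with x hx
    rw [Real.norm_eq_abs, abs_abs, hvdef, abs_mul]
    exact mul_le_mul_of_nonneg_right (hC x hx) (abs_nonneg _)
  have : Fact (1 ≤ ENNReal.ofReal q) := ⟨by simpa using hpq.symm.lt.le⟩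
  have hfin : IsFiniteMeasure (volume.restrict (Metric.closedBall y k⁻¹)) :=
    ⟨by rw [Measure.restrict_apply_univ]; exact measure_closedBall_lt_top⟩
  have hvi : IntegrableOn (fun x => |v x|) (Metric.closedBall y k⁻¹) :=
    hvq.integrable Fact.out
  have holder := integral_mul_le_Lp_mul_Lq_of_nonneg hpq
    (μ := volume.restrict (Metric.closedBall y k⁻¹)) (f := fun _ => (1 : ℝ))
    (g := fun x => |v x|) (Eventually.of_forall fun _ => zero_le_one)
    (Eventually.of_forall fun _ => abs_nonneg _) (memLp_const 1) hvq
  simp only [one_mul, Real.one_rpow, setIntegral_const, smul_eq_mul, mul_one] at holder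
  -- The prefactor is shared between the two Hölder factors: `k^d` times the volume of the ball is
  -- the constant `V`, and the rest is `I k`.
  have hsplit : k ^ finrank ℝ E =
      (k ^ finrank ℝ E) ^ (1 / p) * (k ^ finrank ℝ E) ^ (1 / q) := by
    rw [← Real.rpow_add (by positivity), one_div, one_div, hpq.inv_add_inv_eq_one, Real.rpow_one]
  have hX : 0 ≤ ∫ x in Metric.closedBall y k⁻¹, |v x| ^ q :=
    integral_nonneg fun x => by positivity
  have hmean : k ^ finrank ℝ E * ∫ x in Metric.closedBall y k⁻¹, |v x|
      ≤ V ^ (1 / p) * I k ^ (1 / q) := by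
    calc k ^ finrank ℝ E * ∫ x in Metric.closedBall y k⁻¹, |v x|
        ≤ k ^ finrank ℝ E * (volume.real (Metric.closedBall y k⁻¹) ^ (1 / p) *
          (∫ x in Metric.closedBall y k⁻¹, |v x| ^ q) ^ (1 / q)) :=
          mul_le_mul_of_nonneg_left holder (by positivity)
      _ = _ := by
          rw [hI, hV, ← pow_mul_measureReal_closedBall_inv y hk0,
            Real.mul_rpow (by positivity) measureReal_nonneg,
            Real.mul_rpow (by positivity) hX]
          nth_rewrite 1 [hsplit]
          ring
  refine le_trans ?_ (mul_le_mul_of_nonneg_left hmean hA0)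
  rw [radialMean, ← integral_const_mul, ← integral_const_mul,
    ← integral_indicator measurableSet_closedBall]
  refine norm_integral_le_of_norm_le ?_ (Eventually.of_forall fun x => ?_)
  · exact (integrable_indicator_iff measurableSet_closedBall).2 ((hvi.const_mul _).const_mul _)
  · by_cases hx : x ∈ Metric.closedBall y k⁻¹
    · rw [Set.indicator_of_mem hx, norm_mul, norm_mul,
        Real.norm_of_nonneg (by positivity : 0 ≤ k ^ finrank ℝ E), ← mul_assoc, mul_comm A]
      refine mul_le_mul_of_nonneg_right ?_ (norm_nonneg _)
      exact mul_le_mul_of_nonneg_left (hA _ (by positivity)) (by positivity)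
    · rw [hη0 _ (one_lt_sq_mul_norm_sub_sq hk0 hx)]
      simp [hx]

theorem integral_comp_norm_sq_pos {η : ℝ → ℝ} (hη : Continuous η) (hη0 : ∀ s, 1 < s → η s = 0)
    (hη1 : ∀ s, 0 ≤ η s) (hpos : 0 < η 0) : 0 < ∫ x : E, η (‖x‖ ^ 2) := by
  have hc : Continuous fun x : E => η (‖x‖ ^ 2) := by fun_prop
  refine hc.integral_pos_of_hasCompactSupport_nonneg_nonzero ?_ (fun x => hη1 _) (x := 0) ?_
  · refine HasCompactSupport.intro (isCompact_closedBall (0 : E) 1⁻¹) fun x hx => hη0 _ ?_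
    simpa using one_lt_sq_mul_norm_sub_sq one_pos hx
  · simpa using hpos.ne'

/-- A function `g ∈ L^q` such that `(1 + |x|^α) g`, with `α q = d`, is distributionally harmonic
vanishes almost everywhere. -/
theorem ae_eq_zero_of_weighted_weakly_harmonic {p q α : ℝ} (hpq : p.HolderConjugate q)
    (hd : 0 < finrank ℝ E) (hα : α * q = finrank ℝ E) {g : E → ℝ}
    (hg : MemLp g (ENNReal.ofReal q))
    (hharm : ∀ u : E → ℝ, ContDiff ℝ ((⊤ : ℕ∞) : WithTop ℕ∞) u → HasCompactSupport u →
      ∫ x, Laplacian.laplacian u x * ((1 + ‖x‖ ^ α) * g x) = 0) : g =ᵐ[volume] 0 := by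
  have hq : 0 < q := hpq.symm.pos
  have hα0 : 0 ≤ α := nonneg_of_mul_nonneg_left (hα ▸ Nat.cast_nonneg _) hq
  have hw : Continuous fun x : E => 1 + ‖x‖ ^ α :=
    continuous_const.add (continuous_norm.rpow_const fun _ => Or.inr hα0)
  have hv : LocallyIntegrable fun x => (1 + ‖x‖ ^ α) * g x := by
    have h1 : LocallyIntegrable g := hg.locallyIntegrable (by simpa using hpq.symm.lt.le)
    have h2 := h1.locallyIntegrableOn Set.univ
    rw [← locallyIntegrableOn_univ]
    exact h2.continuousOn_mul hw.continuousOn isOpen_univ.isLocallyClosed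
  obtain ⟨H, hH, hH0, hH1, hHpos⟩ := exists_smooth_profile
  have hH0' (s : ℝ) (hs : 1 < s) : H s = 0 := hH0 s hs.le
  have hη : Continuous (deriv H) := hH.continuous_deriv (by simp)
  have hη0 := deriv_eq_zero_of_eq_zero_of_one_lt hH0'
  have hc := integral_comp_norm_sq_pos (E := E) hη hη0 hH1 hHpos
  filter_upwards [ae_tendsto_radialMean_atTop hη hη0 hc.ne' hv] with y hy
  have hconst (k : ℝ) (hk : 0 < k) := radialMean_eq_of_weakly_harmonic hH hH0' hv hharm y hk one_pos
  have l0 := tendsto_radialMean_zero hη hη0 hpq hd hα hg y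
  have e0 : radialMean (deriv H) (fun x => (1 + ‖x‖ ^ α) * g x) y 1 = 0 := by
    refine tendsto_nhds_unique (tendsto_const_nhds.congr' ?_) l0
    filter_upwards [self_mem_nhdsWithin] with k hk using (hconst k hk).symm
  have e1 : (∫ x : E, deriv H (‖x‖ ^ 2)) * ((1 + ‖y‖ ^ α) * g y) = 0 := by
    refine tendsto_nhds_unique hy (tendsto_const_nhds.congr' ?_)
    filter_upwards [eventually_gt_atTop 0] with k hk
    rw [hconst k hk, e0]
  have hw0 : 0 < 1 + ‖y‖ ^ α := by positivity
  simpa [hc.ne', hw0.ne'] using e1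

end RadialLimits

/-! ### Density of the range of `L` -/

section Density

variable {𝕜 : Type*} [RCLike 𝕜] {N : ℕ} {α : ℝ} {p : ℝ≥0∞}

theorem contDiffAt_two_of_mem_testFunctions {u : EuclideanSpace ℝ (Fin N) → 𝕜}
    (hu : u ∈ testFunctions 𝕜 N) (x : EuclideanSpace ℝ (Fin N)) : ContDiffAt ℝ 2 u x :=
  (hu.1.of_le (by norm_cast)).contDiffAt

/-- `L(C_c^∞)` as a real subspace of `L^p`. -/
def imageLSubmodule (𝕜 : Type*) [RCLike 𝕜] (N : ℕ) (α : ℝ) (p : ℝ≥0∞) :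
    Submodule ℝ (Lp 𝕜 p (volume : Measure (EuclideanSpace ℝ (Fin N)))) where
  carrier := imageL 𝕜 N α p
  zero_mem' := by
    refine ⟨0, ⟨contDiff_const, HasCompactSupport.zero⟩, ?_⟩
    filter_upwards [Lp.coeFn_zero 𝕜 p (volume : Measure (EuclideanSpace ℝ (Fin N)))] with x hx
    have h0 := congrFun (InnerProductSpace.laplacian_const (E := EuclideanSpace ℝ (Fin N))
      (c := (0 : 𝕜))) x
    rw [hx, opL]
    exact (smul_eq_zero_of_right _ h0).symm
  add_mem' := by
    rintro f g ⟨u, hu, hf⟩ ⟨w, hw, hg⟩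
    refine ⟨u + w, ⟨hu.1.add hw.1, hu.2.add hw.2⟩, ?_⟩
    filter_upwards [Lp.coeFn_add f g, hf, hg] with x h1 h2 h3
    rw [h1, Pi.add_apply, h2, h3, opL, opL, opL, ContDiffAt.laplacian_add
      (contDiffAt_two_of_mem_testFunctions hu x) (contDiffAt_two_of_mem_testFunctions hw x),
      smul_add]
  smul_mem' := by
    rintro c f ⟨u, hu, hf⟩
    refine ⟨c • u, ⟨hu.1.const_smul c, hu.2.smul_left (f := fun _ => c)⟩, ?_⟩
    filter_upwards [Lp.coeFn_smul c f, hf] with x h1 h2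
    rw [h1, Pi.smul_apply, h2, opL, opL, InnerProductSpace.laplacian_smul c
      (contDiffAt_two_of_mem_testFunctions hu x), smul_comm]

/-- A subspace of a real normed space is dense if every functional vanishing on it is zero. -/
theorem Submodule.dense_of_forall_clm_eq_zero {F : Type*} [NormedAddCommGroup F] [NormedSpace ℝ F]
    (V : Submodule ℝ F) (h : ∀ Λ : F →L[ℝ] ℝ, (∀ x ∈ V, Λ x = 0) → Λ = 0) :
    Dense (V : Set F) := by
  intro x
  by_contra hx
  obtain ⟨Λ, c, hV, hxc⟩ := geometric_hahn_banach_closed_point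
    (s := (V.topologicalClosure : Set F)) (Submodule.convex _)
    V.isClosed_topologicalClosure hx
  have hc : 0 < c := by simpa using hV 0 (zero_mem _)
  have hzero : ∀ z ∈ V, Λ z = 0 := by
    intro z hz
    by_contra hne
    -- A functional bounded above by `c` on a subspace vanishes there: otherwise this multiple of
    -- `z` would take the value `c` itself.
    have := hV ((c / Λ z) • z)
      (V.le_topologicalClosure (V.smul_mem _ hz))
    rw [map_smul, smul_eq_mul, div_mul_cancel₀ _ hne] at this
    exact lt_irrefl _ this
  rw [h Λ hzero] at hxc
  simp only [zero_apply] at hxc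
  exact lt_asymm hc hxc

theorem dense_imageL_real (hN : 1 ≤ N) [Fact (1 ≤ p)] (hp_top : p ≠ ⊤) {q : ℝ}
    (hpq : p.toReal.HolderConjugate q) (hα : α = N / q) : Dense (imageL ℝ N α p) := by
  have hq : 0 < q := hpq.symm.pos
  have hα0 : 0 ≤ α := by rw [hα]; positivity
  refine Submodule.dense_of_forall_clm_eq_zero (imageLSubmodule ℝ N α p) fun Λ hΛ => ?_
  obtain ⟨g, hg, hrep⟩ := exists_memLp_apply_eq_integral hp_top hpq Λ
  have hg0 : g =ᵐ[volume] 0 := by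
    refine ae_eq_zero_of_weighted_weakly_harmonic (α := α) hpq (by rw [finrank_euclideanSpace_fin]; exact hN) ?_ hg ?_
    · rw [hα, div_mul_cancel₀ _ hq.ne', finrank_euclideanSpace_fin]
    · intro u hu huc
      have hmem : u ∈ testFunctions ℝ N := ⟨hu, huc⟩
      have h1 := hΛ ((memLp_opL hα0 p hmem).toLp _) ⟨u, hmem, MemLp.coeFn_toLp _⟩
      rw [(hrep _ (memLp_opL hα0 p hmem)).2] at h1
      rw [← h1]
      congr 1 with x
      simp only [opL, smul_eq_mul]
      ring
  ext f
  have h1 := (hrep f (Lp.memLp f)).2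
  rw [Lp.toLp_coeFn] at h1
  rw [h1, zero_apply]
  refine integral_eq_zero_of_ae ?_
  filter_upwards [hg0] with x hx
  simp [hx]

/-- A constant real-linear map commutes with the Laplacian and with the real weight, so real
approximations transfer to `𝕜`. -/
theorem compLpL_mem_imageL [Fact (1 ≤ p)] (l : ℝ →L[ℝ] 𝕜)
    {f : Lp ℝ p (volume : Measure (EuclideanSpace ℝ (Fin N)))} (hf : f ∈ imageL ℝ N α p) :
    l.compLpL p volume f ∈ imageL 𝕜 N α p := by
  obtain ⟨u, hu, hfu⟩ := hf
  refine ⟨l ∘ u, ⟨l.contDiff.comp hu.1, hu.2.comp_left (map_zero l)⟩, ?_⟩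
  filter_upwards [l.coeFn_compLpL f, hfu] with x h1 h2
  rw [h1, h2, opL, opL, map_smul, (contDiffAt_two_of_mem_testFunctions hu x).laplacian_CLM_comp_left]
  rfl

theorem dense_imageL (hN : 1 ≤ N) [Fact (1 ≤ p)] (hp_top : p ≠ ⊤) {q : ℝ}
    (hpq : p.toReal.HolderConjugate q) (hα : α = N / q) : Dense (imageL 𝕜 N α p) := by
  have hreal := dense_imageL_real hN hp_top hpq hα
  have hmem (l : ℝ →L[ℝ] 𝕜) (f : Lp ℝ p (volume : Measure (EuclideanSpace ℝ (Fin N)))) :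
      l.compLpL p volume f ∈ (imageLSubmodule 𝕜 N α p).topologicalClosure :=
    map_mem_closure (l.compLpL p volume).continuous (hreal f) fun f hf => compLpL_mem_imageL l hf
  intro f
  -- The real and imaginary parts are approximated separately; the closure of the range is a real
  -- subspace, so it contains their recombination.
  let fr := (RCLike.reCLM : 𝕜 →L[ℝ] ℝ).compLpL p volume f
  let fi := (RCLike.imCLM : 𝕜 →L[ℝ] ℝ).compLpL p volume f
  let lI : ℝ →L[ℝ] 𝕜 := (ContinuousLinearMap.id ℝ ℝ).smulRight (RCLike.I : 𝕜)
  have hsplit : f = (RCLike.ofRealCLM : ℝ →L[ℝ] 𝕜).compLpL p volume fr +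
      lI.compLpL p volume fi := by
    refine Lp.ext ?_
    filter_upwards [Lp.coeFn_add ((RCLike.ofRealCLM : ℝ →L[ℝ] 𝕜).compLpL p volume fr)
      (lI.compLpL p volume fi), (RCLike.ofRealCLM : ℝ →L[ℝ] 𝕜).coeFn_compLpL fr,
      lI.coeFn_compLpL fi, (RCLike.reCLM : 𝕜 →L[ℝ] ℝ).coeFn_compLpL f,
      (RCLike.imCLM : 𝕜 →L[ℝ] ℝ).coeFn_compLpL f] with x h1 h2 h3 h4 h5
    rw [h1, Pi.add_apply, h2, h3]
    simp only [fr, fi, h4, h5, lI]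
    simp [RCLike.real_smul_eq_coe_mul, RCLike.re_add_im]
  rw [hsplit]
  exact add_mem (hmem _ _) (hmem _ _)

/-! ### Integrability of the reciprocal weight and failure of density. -/

theorem inv_one_add_rpow_le {t : ℝ} (ht : 0 ≤ t) (hα : 0 ≤ α) :
    (1 + t ^ α)⁻¹ ≤ 2 ^ α * (1 + t) ^ (-α) := by
  rw [Real.rpow_neg (by positivity), ← div_eq_mul_inv, inv_le_comm₀ (by positivity) (by positivity),
    inv_div, div_le_iff₀ (by positivity)]
  -- `1 + t` is at most `2` for `t ≤ 1` and at most `2t` for `t ≥ 1`.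
  rcases le_total t 1 with h | h
  · calc (1 + t) ^ α ≤ 2 ^ α := Real.rpow_le_rpow (by positivity) (by linarith) hα
      _ ≤ (1 + t ^ α) * 2 ^ α :=
        le_mul_of_one_le_left (by positivity) (by linarith [Real.rpow_nonneg ht α])
  · calc (1 + t) ^ α ≤ (t * 2) ^ α := Real.rpow_le_rpow (by positivity) (by linarith) hα
      _ = t ^ α * 2 ^ α := Real.mul_rpow ht (by norm_num)
      _ ≤ (1 + t ^ α) * 2 ^ α := by gcongr; linarith

theorem memLp_inv_one_add_norm_rpow {E : Type*} [NormedAddCommGroup E] [NormedSpace ℝ E]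
    [FiniteDimensional ℝ E] [MeasurableSpace E] [BorelSpace E] (μ : Measure E)
    [μ.IsAddHaarMeasure] {q : ℝ} (hq : 0 < q) (hα : 0 ≤ α) (h : Module.finrank ℝ E < α * q) :
    MemLp (fun x : E => (1 + ‖x‖ ^ α)⁻¹) (ENNReal.ofReal q) μ := by
  have h1 : MemLp (fun x : E => (1 + ‖x‖) ^ (-α)) (ENNReal.ofReal q) μ := by
    rw [← integrable_norm_rpow_iff (Measurable.aestronglyMeasurable (by fun_prop)) (by simpa using hq) ENNReal.ofReal_ne_top,
      ENNReal.toReal_ofReal hq.le]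
    refine (integrable_one_add_norm (μ := μ) h).congr (Eventually.of_forall fun x => ?_)
    simp only
    rw [Real.norm_of_nonneg (by positivity), ← Real.rpow_mul (by positivity), neg_mul]
  refine h1.of_le_mul (c := 2 ^ α) (by fun_prop) (Eventually.of_forall fun x => ?_)
  rw [Real.norm_of_nonneg (by positivity), Real.norm_of_nonneg (by positivity)]
  exact inv_one_add_rpow_le (norm_nonneg x) hα

theorem not_dense_imageL [Fact (1 ≤ p)] (hp_top : p ≠ ⊤) {q : ℝ}
    (hpq : p.toReal.HolderConjugate q) (hα : N / q < α) : ¬ Dense (imageL 𝕜 N α p) := by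
  intro hdense
  have hq : 0 < q := hpq.symm.pos
  have hα0 : 0 ≤ α := le_trans (by positivity) hα.le
  have hw : MemLp (fun x : EuclideanSpace ℝ (Fin N) => (1 + ‖x‖ ^ α)⁻¹) (ENNReal.ofReal q)
      volume := by
    refine memLp_inv_one_add_norm_rpow volume hq hα0 ?_
    rwa [finrank_euclideanSpace_fin, ← div_lt_iff₀ hq]
  have : ENNReal.HolderConjugate (ENNReal.ofReal q) p := by
    rw [← ENNReal.ofReal_toReal hp_top]
    exact hpq.symm.ennrealOfReal
  have : Fact (1 ≤ ENNReal.ofReal q) := ⟨by simpa using hpq.symm.lt.le⟩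
  -- Pairing with the reciprocal weight cancels the weight in `L u` and leaves `∫ Δu = 0`.
  let T : Lp 𝕜 p (volume : Measure (EuclideanSpace ℝ (Fin N))) →L[ℝ] 𝕜 :=
    (ContinuousLinearMap.lsmul ℝ ℝ : ℝ →L[ℝ] 𝕜 →L[ℝ] 𝕜).lpPairing volume (ENNReal.ofReal q) p
      (hw.toLp _)
  have hT (f : Lp 𝕜 p (volume : Measure (EuclideanSpace ℝ (Fin N)))) :
      T f = ∫ x, (1 + ‖x‖ ^ α)⁻¹ • f x := by
    rw [ContinuousLinearMap.lpPairing_eq_integral]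
    refine integral_congr_ae ?_
    filter_upwards [hw.coeFn_toLp] with x hx
    rw [hx, ContinuousLinearMap.lsmul_apply]
  have hT0 : Set.EqOn T 0 (imageL 𝕜 N α p) := by
    rintro f ⟨u, hu, hfu⟩
    rw [hT, Pi.zero_apply,
      ← integral_laplacian_eq_zero (hu.1.of_le (by norm_cast)) hu.2]
    refine integral_congr_ae ?_
    filter_upwards [hfu] with x hx
    rw [hx, opL, inv_smul_smul₀ (by positivity)]
  have hzero : (T : _ → 𝕜) = 0 := Continuous.ext_on hdense T.continuous continuous_zero hT0
  let B := Metric.ball (0 : EuclideanSpace ℝ (Fin N)) 1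
  -- Density would force this functional to be zero, but on the indicator of the unit ball it is the
  -- integral of a positive function.
  have h1 := congrFun hzero (indicatorConstLp p (measurableSet_ball (x := 0) (ε := 1))
    measure_ball_lt_top.ne (1 : 𝕜))
  rw [hT, Pi.zero_apply] at h1
  have h2 : ∫ x in B, (1 + ‖x‖ ^ α)⁻¹ = 0 := by
    have h3 : ((∫ x in B, (1 + ‖x‖ ^ α)⁻¹ : ℝ) : 𝕜) = 0 := by
      rw [← integral_ofReal, ← integral_indicator measurableSet_ball, ← h1]
      refine integral_congr_ae ?_
      filter_upwards [indicatorConstLp_coeFn (p := p) (hs := measurableSet_ball (x := 0) (ε := 1))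
        (hμs := measure_ball_lt_top.ne) (c := (1 : 𝕜))] with x hx
      rw [hx]
      by_cases hxB : x ∈ B
      · rw [Set.indicator_of_mem hxB, Set.indicator_of_mem hxB, RCLike.real_smul_eq_coe_mul,
          mul_one]
      · rw [Set.indicator_of_notMem hxB, Set.indicator_of_notMem hxB, smul_zero]
    exact_mod_cast h3
  have hfin : IsFiniteMeasure (volume.restrict B) :=
    ⟨by rw [Measure.restrict_apply_univ]; exact measure_ball_lt_top⟩
  have hint : IntegrableOn (fun x : EuclideanSpace ℝ (Fin N) => (1 + ‖x‖ ^ α)⁻¹) B :=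
    (hw.restrict B).integrable Fact.out
  have hpos : 0 < ∫ x in B, (1 + ‖x‖ ^ α)⁻¹ := by
    rw [setIntegral_pos_iff_support_of_nonneg_ae
      (Eventually.of_forall fun x => by positivity) hint]
    have hsupp : (Function.support fun x : EuclideanSpace ℝ (Fin N) => (1 + ‖x‖ ^ α)⁻¹)
        = Set.univ := by
      refine Set.eq_univ_of_forall fun x => ?_
      have : 0 < (1 + ‖x‖ ^ α)⁻¹ := by positivity
      exact this.ne'
    rw [hsupp, Set.univ_inter]
    exact Metric.measure_ball_pos _ _ one_pos
  exact hpos.ne' h2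

end Density

theorem mainTheorem12 {𝕜 : Type*} [RCLike 𝕜] (N : ℕ) (hN : 1 ≤ N)
    (p : ℝ≥0∞) [Fact (1 ≤ p)] (hp_one : 1 < p) (hp_top : p ≠ ⊤)
    (p' : ℝ) (hpp' : p.toReal.HolderConjugate p') (α : ℝ) :
    (α = (N : ℝ) / p' → Dense (imageL 𝕜 N α p)) ∧
      ((N : ℝ) / p' < α → ¬ Dense (imageL 𝕜 N α p)) :=
  ⟨fun h => dense_imageL hN hp_top hpp' h, fun h => not_dense_imageL hp_top hpp' h⟩
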